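/- For every $n\in\mathbb{N}$ let $A_n=\sum_{k=0}^{n}\binom{n+k}{k}^2\binom{n}{k}^2$ denote the $n$-th Apéry number, and let $H_n=\sum_{k=1}^{n}\frac1k$ denote the $n$-th harmonic number. Then for every prime $p\ge 7$, $$\sum_{k=0}^{p-1}(2k+1)A_k\equiv p-\frac72\,p^2H_{p-1}\pmod{p^6}.$$ Here, for rational numbers $a,b$ and a positive integer $m$, $a\equiv b\pmod m$ means that $a-b=m r$ for some rational number $r$ whose denominator in lowest terms is coprime to $m$. -/

import Mathlib

/-- The Apéry numbers `A_n = ∑_{k=0}^n C(n+k,k)^2 C(n,k)^2`. -/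
def aperyNumber (n : ℕ) : ℕ :=
  ∑ k ∈ Finset.range (n + 1), (n + k).choose k ^ 2 * n.choose k ^ 2

/-- Congruence of rational numbers modulo a natural number `m`: the difference `a - b` is `m` times
a rational number whose reduced denominator is coprime to `m`. -/
def RatModEq (m : ℕ) (a b : ℚ) : Prop :=
  ∃ r : ℚ, r.den.Coprime m ∧ a - b = (m : ℚ) * r

open Finset

/-! ### The signed products `(-1)^j (n - j) C(n+j,j) C(n,j)` -/

/-! Summing over `k` first, the `j`-th inner sum telescopes, so the left side is `∑ ((p - j)
C(p+j,j) C(p,j))^2 / (2j+1)`. The base of each square is `± p S_j` with `S_j = ∏_{i ≤ j} (1 -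
p^2/i^2)`. Put `S^2 = 2S - 1 + (1 - S)^2`. For odd `p` the linear part is exact: `∑ p S_j / (2j+1) =
1`. Hence the sum equals `2p - p^2 ∑ 1/(2j+1) + p^2 ∑ (1 - S_j)^2 / (2j+1)`
(`sum_odd_mul_aperyNumber_eq`). Modulo `p^4` the last sum vanishes
(`powDvd_sum_one_sub_sineProd_sq`) and `∑ 1/(2j+1)` is `1/p + (7/2) H_{p-1}` (`powDvd_sum_inv_odd`).
-/

theorem cast_succ_mul_choose_succ (n j : ℕ) :
    ((j : ℚ) + 1) * (n.choose (j + 1) : ℚ) = ((n : ℚ) - j) * n.choose j := by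
  rcases le_or_gt j n with h | h
  · have := Nat.choose_succ_right_eq n j
    have h' : ((n.choose (j + 1) * (j + 1) : ℕ) : ℚ) = ((n.choose j * (n - j) : ℕ) : ℚ) := by
      rw [this]
    push_cast [Nat.cast_sub h] at h'
    linarith
  · simp [Nat.choose_eq_zero_of_lt h, Nat.choose_eq_zero_of_lt (Nat.lt_succ_of_lt h)]

theorem cast_sub_mul_succ_choose (n j : ℕ) :
    ((n : ℚ) + 1 - j) * ((n + 1).choose j : ℚ) = ((n : ℚ) + 1) * n.choose j := by
  rcases le_or_gt j (n + 1) with h | h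
  · have h' : ((n.choose j * (n + 1) : ℕ) : ℚ) = (((n + 1).choose j * (n + 1 - j) : ℕ) : ℚ) := by
      rw [Nat.choose_mul_succ_eq]
    push_cast [Nat.cast_sub h] at h'
    linarith
  · simp [Nat.choose_eq_zero_of_lt h, Nat.choose_eq_zero_of_lt (Nat.lt_of_succ_lt h)]

theorem cast_succ_mul_add_succ_choose (n j : ℕ) :
    ((j : ℚ) + 1) * ((n + (j + 1)).choose (j + 1) : ℚ) = ((n : ℚ) + j + 1) * (n + j).choose j := by
  have h : (((n + j + 1) * (n + j).choose j : ℕ) : ℚ)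
      = (((n + j + 1).choose (j + 1) * (j + 1) : ℕ) : ℚ) := by
    rw [Nat.add_one_mul_choose_eq]
  push_cast at h
  rw [← add_assoc n j 1]
  linarith

theorem cast_succ_mul_succ_add_choose (n j : ℕ) :
    ((n : ℚ) + 1) * ((n + 1 + j).choose j : ℚ) = ((n : ℚ) + 1 + j) * (n + j).choose j := by
  have h := cast_sub_mul_succ_choose (n + j) j
  rw [show n + j + 1 = n + 1 + j by ring] at h
  push_cast at h
  linear_combination h

/-- `C(n+j,j) C(n,j)`. -/
def legendreCoeff (n j : ℕ) : ℚ := ((n + j).choose j : ℚ) * n.choose j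

theorem legendreCoeff_zero_right (n : ℕ) : legendreCoeff n 0 = 1 := by
  simp [legendreCoeff]

theorem legendreCoeff_zero_succ (j : ℕ) : legendreCoeff 0 (j + 1) = 0 := by
  simp [legendreCoeff]

theorem legendreCoeff_of_lt {n j : ℕ} (h : n < j) : legendreCoeff n j = 0 := by
  simp [legendreCoeff, Nat.choose_eq_zero_of_lt h]

theorem legendreCoeff_succ_left (n j : ℕ) :
    ((n : ℚ) + 1 - j) * legendreCoeff (n + 1) j = ((n : ℚ) + 1 + j) * legendreCoeff n j := by
  unfold legendreCoeff
  linear_combination ((n + 1 + j).choose j : ℚ) * cast_sub_mul_succ_choose n j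
    + (n.choose j : ℚ) * cast_succ_mul_succ_add_choose n j

theorem legendreCoeff_succ_right (n j : ℕ) :
    ((j : ℚ) + 1) ^ 2 * legendreCoeff n (j + 1)
      = ((n : ℚ) - j) * ((n : ℚ) + j + 1) * legendreCoeff n j := by
  unfold legendreCoeff
  linear_combination
    ((j : ℚ) + 1) * ((n + (j + 1)).choose (j + 1) : ℚ) * cast_succ_mul_choose_succ n j
    + ((n : ℚ) - j) * n.choose j * cast_succ_mul_add_succ_choose n j

/-- Telescopes: `legendreCoeff_succ_left` makes the increment of the right side `((n+1+j)^2 -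
(n-j)^2) L^2 = (2n+1)(2j+1) L^2`, where `L = legendreCoeff n j`. -/
theorem sum_odd_mul_legendreCoeff_sq (n j : ℕ) :
    (2 * (j : ℚ) + 1) * ∑ k ∈ range n, (2 * (k : ℚ) + 1) * legendreCoeff k j ^ 2
      = (((n : ℚ) - j) * legendreCoeff n j) ^ 2 := by
  induction n with
  | zero => cases j <;> simp [legendreCoeff_zero_succ]
  | succ n ih =>
    rw [sum_range_succ, mul_add, ih]
    push_cast
    rw [legendreCoeff_succ_left]
    ring

theorem sum_odd_mul_aperyNumber (n : ℕ) :
    ∑ k ∈ range n, (2 * (k : ℚ) + 1) * (aperyNumber k : ℚ)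
      = ∑ j ∈ range n, (((n : ℚ) - j) * legendreCoeff n j) ^ 2 / (2 * (j : ℚ) + 1) := by
  have h : ∀ k ∈ range n, (aperyNumber k : ℚ) = ∑ j ∈ range n, legendreCoeff k j ^ 2 := by
    intro k hk
    rw [← sum_subset (range_mono (Nat.succ_le_of_lt (mem_range.1 hk)))]
    · simp [aperyNumber, legendreCoeff, mul_pow]
    · intro j _ hj
      rw [legendreCoeff_of_lt (by simpa using hj), zero_pow two_ne_zero]
  rw [sum_congr rfl fun k hk => by rw [h k hk, mul_sum], sum_comm]
  refine sum_congr rfl fun j _ => ?_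
  rw [eq_div_iff (by positivity), ← sum_odd_mul_legendreCoeff_sq]
  ring

/-! ### Exact alternating sums with weights `1/(2j+1)` -/

theorem sum_alternating_legendreCoeff_aux (n m : ℕ) :
    ((n : ℚ) + 1) ^ 2 *
        ∑ j ∈ range m, (-1) ^ j * (((n + j).choose j : ℚ) * (n + 1).choose j)
      = -((-1) ^ m * (m : ℚ) ^ 2 * (((n + m).choose m : ℚ) * (n + 1).choose m)) := by
  induction m with
  | zero => simp
  | succ m ih =>
    rw [sum_range_succ, mul_add, ih, pow_succ]
    push_cast
    have h := cast_succ_mul_choose_succ (n + 1) m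
    push_cast at h
    linear_combination (-(-1 : ℚ) ^ m) * (
      ((m : ℚ) + 1) * ((n + (m + 1)).choose (m + 1) : ℚ) * h
      + ((n : ℚ) + 1 - m) * (n + 1).choose m * cast_succ_mul_add_succ_choose n m)

/-- This is `∫_0^1 P_n(1 - 2x^2) dx = 1/(2n+1)` for the Legendre polynomial `P_n`. In the difference
of consecutive `n` the denominator `2j+1` cancels, leaving a sum with closed-form partial sums. -/
theorem sum_alternating_legendreCoeff_div_odd {n N : ℕ} (h : n < N) :
    (2 * (n : ℚ) + 1) * ∑ j ∈ range N, (-1) ^ j * legendreCoeff n j / (2 * (j : ℚ) + 1) = 1 := by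
  induction n with
  | zero =>
    rw [sum_eq_single_of_mem 0 (mem_range.2 h)]
    · simp [legendreCoeff_zero_right]
    · intro j _ hj
      obtain ⟨i, rfl⟩ := Nat.exists_eq_succ_of_ne_zero hj
      simp [legendreCoeff_zero_succ]
  | succ n ih =>
    refine Eq.trans (sub_eq_zero.1 ?_) (ih (by omega))
    rw [mul_sum, mul_sum, ← sum_sub_distrib]
    have key : ∀ j ∈ range N,
        (2 * ((n + 1 : ℕ) : ℚ) + 1) * ((-1) ^ j * legendreCoeff (n + 1) j / (2 * (j : ℚ) + 1))
          - (2 * (n : ℚ) + 1) * ((-1) ^ j * legendreCoeff n j / (2 * (j : ℚ) + 1))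
        = 2 * ((-1) ^ j * (((n + j).choose j : ℚ) * (n + 1).choose j)) := by
      intro j _
      have h1 := cast_succ_mul_succ_add_choose n j
      have h2 := cast_sub_mul_succ_choose n j
      have hn : (n : ℚ) + 1 ≠ 0 := by positivity
      have hj : 2 * (j : ℚ) + 1 ≠ 0 := by positivity
      unfold legendreCoeff
      push_cast
      rw [← mul_div_assoc, ← mul_div_assoc, ← sub_div, div_eq_iff hj]
      apply mul_left_cancel₀ hn
      linear_combination (-1 : ℚ) ^ j * ((2 * (n : ℚ) + 3) * (n + 1).choose j * h1
        + (2 * (n : ℚ) + 1) * (n + j).choose j * h2)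
    rw [sum_congr rfl key, ← mul_sum]
    -- The closed form contains `C(n+1,N)`, which is zero since `n + 1 < N`.
    have h0 := sum_alternating_legendreCoeff_aux n N
    rw [Nat.choose_eq_zero_of_lt h] at h0
    have hn : ((n : ℚ) + 1) ^ 2 ≠ 0 := by positivity
    have := mul_eq_zero.1 (h0.trans (by simp))
    rw [this.resolve_left hn, mul_zero]

/-- Since `n+1+j = (2n+1) - (n-j)`, the sums satisfy `T_{n+1} = 1 - T_n`, with `T_0 = 0`. -/
theorem sum_alternating_sub_mul_legendreCoeff {n N : ℕ} (h : n < N) :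
    ∑ j ∈ range N, (-1) ^ j * (((n : ℚ) - j) * legendreCoeff n j) / (2 * (j : ℚ) + 1)
      = if Odd n then 1 else 0 := by
  induction n with
  | zero =>
    simp only [Nat.not_odd_zero, if_false]
    refine sum_eq_zero fun j _ => ?_
    cases j <;> simp [legendreCoeff_zero_succ]
  | succ n ih =>
    have h1 := sum_alternating_legendreCoeff_div_odd (show n < N by omega)
    have key : ∀ j ∈ range N,
        (-1 : ℚ) ^ j * ((((n + 1 : ℕ) : ℚ) - j) * legendreCoeff (n + 1) j) / (2 * (j : ℚ) + 1)
        = (2 * (n : ℚ) + 1) * ((-1) ^ j * legendreCoeff n j / (2 * (j : ℚ) + 1))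
          - (-1) ^ j * (((n : ℚ) - j) * legendreCoeff n j) / (2 * (j : ℚ) + 1) := by
      intro j _
      push_cast
      rw [legendreCoeff_succ_left]
      ring
    rw [sum_congr rfl key, sum_sub_distrib, ← mul_sum, h1, ih (by omega)]
    by_cases hn : Odd n <;> simp [hn, Nat.odd_add_one]

/-- `∏_{1 ≤ i ≤ j} (1 - n^2 / i^2)`. -/
def sineProd (n j : ℕ) : ℚ := ∏ i ∈ range j, (1 - (n : ℚ) ^ 2 * (((i : ℚ) + 1)⁻¹) ^ 2)

theorem sub_mul_legendreCoeff (n j : ℕ) :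
    ((n : ℚ) - j) * legendreCoeff n j = (-1) ^ j * (n * sineProd n j) := by
  induction j with
  | zero => simp [legendreCoeff_zero_right, sineProd]
  | succ j ih =>
    have hj : (j : ℚ) + 1 ≠ 0 := by positivity
    have h := legendreCoeff_succ_right n j
    rw [sineProd, prod_range_succ, ← sineProd, pow_succ]
    apply mul_left_cancel₀ (pow_ne_zero 2 hj)
    have e : ((j : ℚ) + 1) ^ 2 * (1 - (n : ℚ) ^ 2 * (((j : ℚ) + 1)⁻¹) ^ 2)
        = ((j : ℚ) + 1) ^ 2 - (n : ℚ) ^ 2 := by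
      field_simp
    push_cast
    linear_combination ((n : ℚ) - (j + 1)) * h
      + (((n : ℚ) - (j + 1)) * (n + j + 1)) * ih + (-1 : ℚ) ^ j * (n * sineProd n j) * e

theorem sum_sineProd_div_odd {n : ℕ} (hn : Odd n) :
    ∑ j ∈ range n, n * sineProd n j / (2 * (j : ℚ) + 1) = 1 := by
  -- The range must reach `j = n`, but that term vanishes through its factor `n - j`.
  have h := sum_alternating_sub_mul_legendreCoeff (Nat.lt_succ_self n)
  rw [if_pos hn, Nat.succ_eq_add_one, sum_range_succ] at h
  simp only [sub_self, zero_mul, mul_zero, zero_div, add_zero] at h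
  refine Eq.trans (sum_congr rfl fun j _ => ?_) h
  rw [sub_mul_legendreCoeff, ← mul_assoc, ← mul_pow]
  simp

theorem sum_odd_mul_aperyNumber_eq {n : ℕ} (hn : Odd n) :
    ∑ k ∈ range n, (2 * (k : ℚ) + 1) * (aperyNumber k : ℚ)
      = 2 * n + (n : ℚ) ^ 2 * (∑ j ∈ range n, (1 - sineProd n j) ^ 2 / (2 * (j : ℚ) + 1)
          - ∑ j ∈ range n, 1 / (2 * (j : ℚ) + 1)) := by
  have h := congrArg (fun x => 2 * (n : ℚ) * x) (sum_sineProd_div_odd hn)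
  simp only [mul_one] at h
  rw [sum_odd_mul_aperyNumber, ← sum_sub_distrib, mul_sum, ← h, mul_sum, ← sum_add_distrib]
  refine sum_congr rfl fun j _ => ?_
  have e : ((-1 : ℚ) ^ j) ^ 2 = 1 := by rw [← pow_mul, mul_comm, pow_mul]; simp
  rw [sub_mul_legendreCoeff, mul_pow, e]
  ring

theorem sum_range_reflect_pred (p : ℕ) (f : ℚ → ℚ) :
    ∑ i ∈ range (p - 1), f ((p : ℚ) - (i + 1)) = ∑ i ∈ range (p - 1), f ((i : ℚ) + 1) := by
  rw [← sum_range_reflect]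
  refine sum_congr rfl fun i hi => ?_
  have hi := mem_range.1 hi
  rw [Nat.cast_sub (by omega), Nat.cast_sub (by omega), Nat.cast_sub (by omega)]
  push_cast
  congr 1
  ring

/-! ### Divisibility by powers of `p` in the localization of `ℤ` at `p` -/

section Local

variable (p : ℕ) [Fact p.Prime]

/-- The rationals whose denominator is prime to `p`. -/
def localIntegers : Subring ℚ := (Rat.padicValuation p).integer

/-- `a` is `p ^ n` times a rational whose denominator is prime to `p`. -/
def PowDvd (n : ℕ) (a : ℚ) : Prop := ∃ r ∈ localIntegers p, a = (p : ℚ) ^ n * r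

variable {p}

theorem den_coprime_of_mem_localIntegers {r : ℚ} (h : r ∈ localIntegers p) : r.den.Coprime p := by
  have h1 : Rat.padicValuation p r ≤ 1 := h
  rw [Rat.padicValuation_le_one_iff] at h1
  exact (((Fact.out : p.Prime).coprime_iff_not_dvd).2 h1).symm

theorem intCast_inv_mem_localIntegers {z : ℤ} (h : ¬(p : ℤ) ∣ z) : ((z : ℚ))⁻¹ ∈ localIntegers p := by
  change Rat.padicValuation p _ ≤ 1
  rw [Rat.padicValuation_le_one_iff, Rat.inv_intCast_den]
  split_ifs with h0
  · simpa using (Fact.out : p.Prime).one_lt.ne'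
  · rwa [← Int.natCast_dvd]

theorem natCast_inv_mem_localIntegers {l : ℕ} (h : ¬p ∣ l) : ((l : ℚ))⁻¹ ∈ localIntegers p := by
  simpa using intCast_inv_mem_localIntegers (z := l) (by rwa [Int.natCast_dvd_natCast])

namespace PowDvd

variable {n m : ℕ} {a b : ℚ}

theorem of_mem (h : a ∈ localIntegers p) : PowDvd p n ((p : ℚ) ^ n * a) := ⟨a, h, rfl⟩

theorem zero : PowDvd p n 0 := ⟨0, zero_mem _, by simp⟩

theorem add (ha : PowDvd p n a) (hb : PowDvd p n b) : PowDvd p n (a + b) := by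
  obtain ⟨r, hr, rfl⟩ := ha
  obtain ⟨s, hs, rfl⟩ := hb
  exact ⟨r + s, add_mem hr hs, by ring⟩

theorem mul (ha : PowDvd p n a) (hb : PowDvd p m b) : PowDvd p (n + m) (a * b) := by
  obtain ⟨r, hr, rfl⟩ := ha
  obtain ⟨s, hs, rfl⟩ := hb
  exact ⟨r * s, mul_mem hr hs, by ring⟩

theorem mul_left (hb : b ∈ localIntegers p) (ha : PowDvd p n a) : PowDvd p n (b * a) := by
  obtain ⟨r, hr, rfl⟩ := ha
  exact ⟨b * r, mul_mem hb hr, by ring⟩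

theorem neg (ha : PowDvd p n a) : PowDvd p n (-a) := by
  obtain ⟨r, hr, rfl⟩ := ha
  exact ⟨-r, neg_mem hr, by ring⟩

theorem sub (ha : PowDvd p n a) (hb : PowDvd p n b) : PowDvd p n (a - b) := by
  rw [sub_eq_add_neg]
  exact ha.add hb.neg

theorem mono (h : m ≤ n) (ha : PowDvd p n a) : PowDvd p m a := by
  obtain ⟨r, hr, rfl⟩ := ha
  obtain ⟨k, rfl⟩ := Nat.exists_eq_add_of_le h
  exact ⟨(p : ℚ) ^ k * r, mul_mem (pow_mem (natCast_mem _ p) k) hr, by ring⟩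

theorem sum {ι : Type*} {s : Finset ι} {f : ι → ℚ} (h : ∀ i ∈ s, PowDvd p n (f i)) :
    PowDvd p n (∑ i ∈ s, f i) := by
  classical
  induction s using Finset.induction_on with
  | empty => simpa using zero
  | insert i s hi ih =>
    rw [sum_insert hi]
    exact (h i (mem_insert_self i s)).add (ih fun j hj => h j (mem_insert_of_mem hj))

theorem of_two_mul (hp : 2 < p) (h : PowDvd p n (2 * a)) : PowDvd p n a := by
  have := mul_left (natCast_inv_mem_localIntegers (Nat.not_dvd_of_pos_of_lt two_pos hp)) h
  simpa using this

theorem ratModEq (h : PowDvd p n (a - b)) : RatModEq (p ^ n) a b := by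
  obtain ⟨r, hr, h⟩ := h
  exact ⟨r, (den_coprime_of_mem_localIntegers hr).pow_right n, by rw [h]; push_cast; rfl⟩

end PowDvd

/-! ### Harmonic sums -/

theorem natCast_succ_inv_mem {i : ℕ} (h : i + 1 < p) : (((i : ℚ) + 1))⁻¹ ∈ localIntegers p := by
  have := natCast_inv_mem_localIntegers (Nat.not_dvd_of_pos_of_lt i.succ_pos h)
  simpa using this

theorem natCast_sub_succ_inv_mem {i : ℕ} (h : i + 1 < p) :
    (((p : ℚ) - (i + 1)))⁻¹ ∈ localIntegers p := by
  have := natCast_inv_mem_localIntegers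
    (Nat.not_dvd_of_pos_of_lt (Nat.sub_pos_of_lt h) (Nat.sub_lt (by omega) i.succ_pos))
  rwa [Nat.cast_sub h.le, Nat.cast_succ] at this

theorem natCast_add_succ_inv_mem {i : ℕ} (h : i + 1 < p) :
    (((p : ℚ) + (i + 1)))⁻¹ ∈ localIntegers p := by
  have := natCast_inv_mem_localIntegers (p := p) (l := p + (i + 1))
    (by rw [Nat.dvd_add_right dvd_rfl]; exact Nat.not_dvd_of_pos_of_lt i.succ_pos h)
  push_cast at this
  exact this

theorem sum_inv_pow_zmod {s : ℕ} (h0 : s ≠ 0) (hs : s < p - 1) :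
    ∑ i ∈ range (p - 1), (((i : ZMod p) + 1)⁻¹) ^ s = 0 := by
  have h1 : ∑ x : ZMod p, (x⁻¹) ^ s = 0 := by
    rw [← FiniteField.sum_pow_lt_card_sub_one (K := ZMod p) s (by rwa [ZMod.card])]
    exact Equiv.sum_comp (Equiv.inv (ZMod p)) (fun x => x ^ s)
  have h2 : ∑ i ∈ range p, (((i : ZMod p))⁻¹) ^ s = ∑ x : ZMod p, (x⁻¹) ^ s := by
    refine sum_nbij' (fun i => (i : ZMod p)) ZMod.val ?_ ?_ ?_ ?_ ?_
    · simp
    · intro x _; exact mem_range.2 (ZMod.val_lt x)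
    · intro i hi; exact ZMod.val_cast_of_lt (mem_range.1 hi)
    · simp
    · simp
  -- The term of index `0` is `(0⁻¹)^s = 0`, because `0⁻¹ = 0` and `s ≠ 0`.
  rw [h1, show range p = range (p - 1 + 1) by rw [Nat.sub_add_cancel (Fact.out : p.Prime).one_le],
    sum_range_succ'] at h2
  simpa [h0] using h2

/-- Multiplying by `((p-1)!)^s`, prime to `p`, clears denominators and reduces the claim to `ZMod
p`. -/
theorem powDvd_sum_inv_pow {s : ℕ} (h0 : s ≠ 0) (hs : s < p - 1) :
    PowDvd p 1 (∑ i ∈ range (p - 1), (((i : ℚ) + 1)⁻¹) ^ s) := by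
  set M := (p - 1).factorial with hM
  have hpM : ¬p ∣ M := by
    rw [(Fact.out : p.Prime).dvd_factorial]
    have := (Fact.out : p.Prime).pos
    omega
  have hdvd : ∀ i ∈ range (p - 1), i + 1 ∣ M := fun i hi =>
    Nat.dvd_factorial i.succ_pos (mem_range.1 hi)
  have hz : ((∑ i ∈ range (p - 1), (M / (i + 1)) ^ s : ℕ) : ZMod p) = 0 := by
    have := congrArg (fun x => (M : ZMod p) ^ s * x) (sum_inv_pow_zmod h0 hs)
    simp only [mul_zero, mul_sum] at this
    rw [← this]
    push_cast
    refine sum_congr rfl fun i hi => ?_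
    have hi0 : ((i : ZMod p) + 1) ≠ 0 := by
      have hlt := mem_range.1 hi
      have : ((i + 1 : ℕ) : ZMod p) ≠ 0 := by
        rw [Ne, ZMod.natCast_eq_zero_iff]
        exact Nat.not_dvd_of_pos_of_lt i.succ_pos (by omega)
      simpa using this
    rw [← mul_pow]
    congr 1
    rw [eq_mul_inv_iff_mul_eq₀ hi0]
    have := congrArg (Nat.cast : ℕ → ZMod p) (Nat.div_mul_cancel (hdvd i hi))
    push_cast at this
    exact this
  rw [ZMod.natCast_eq_zero_iff] at hz
  obtain ⟨c, hc⟩ := hz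
  refine ⟨((M : ℚ)⁻¹) ^ s * c,
    mul_mem (pow_mem (natCast_inv_mem_localIntegers hpM) s) (natCast_mem _ c), ?_⟩
  have hM0 : (M : ℚ) ≠ 0 := by exact_mod_cast (Nat.factorial_pos _).ne'
  have hq := congrArg (Nat.cast : ℕ → ℚ) hc
  push_cast at hq
  rw [pow_one, mul_left_comm, ← hq, mul_sum]
  refine sum_congr rfl fun i hi => ?_
  rw [← mul_pow, Nat.cast_div (hdvd i hi) (by positivity)]
  congr 1
  push_cast
  field_simp

/-- Pairing `i` with `p - i` gives `1/i^3 + 1/(p-i)^3 ≡ -3p/i^4` modulo `p^2`; then `∑ 1/i^4` is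
divisible by `p`, as `4 < p - 1`. -/
theorem powDvd_two_sum_inv_cube (hp : 7 ≤ p) :
    PowDvd p 2 (∑ i ∈ range (p - 1), (((i : ℚ) + 1)⁻¹) ^ 3) := by
  apply PowDvd.of_two_mul (by omega)
  have h4 : PowDvd p 2 ((p : ℚ) ^ 1 * 1 * (3 * ∑ i ∈ range (p - 1), (((i : ℚ) + 1)⁻¹) ^ 4)) :=
    (PowDvd.of_mem (one_mem _)).mul
      ((powDvd_sum_inv_pow (by norm_num) (by omega)).mul_left (natCast_mem _ 3))
  rw [mul_one] at h4
  have key : 2 * ∑ i ∈ range (p - 1), (((i : ℚ) + 1)⁻¹) ^ 3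
      = ∑ i ∈ range (p - 1), (p : ℚ) ^ 2 * ((3 * (p : ℚ) ^ 2 - 8 * p * ((i : ℚ) + 1)
          + 6 * ((i : ℚ) + 1) ^ 2) * ((((i : ℚ) + 1)⁻¹) ^ 4 * (((p : ℚ) - (i + 1))⁻¹) ^ 3))
        - (p : ℚ) ^ 1 * (3 * ∑ i ∈ range (p - 1), (((i : ℚ) + 1)⁻¹) ^ 4) := by
    rw [two_mul]
    nth_rw 2 [← sum_range_reflect_pred p (fun x => (x⁻¹) ^ 3)]
    rw [mul_sum, mul_sum, ← sum_add_distrib, ← sum_sub_distrib]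
    refine sum_congr rfl fun i hi => ?_
    have h1 : (i : ℚ) + 1 ≠ 0 := by positivity
    have h2 : (p : ℚ) - (i + 1) ≠ 0 := by
      have : ((i + 1 : ℕ) : ℚ) < p := by
        have := mem_range.1 hi
        exact_mod_cast (by omega : i + 1 < p)
      push_cast at this
      linarith
    field_simp
    ring
  rw [key]
  refine (PowDvd.sum fun i hi => PowDvd.of_mem ?_).sub h4
  have hlt : i + 1 < p := by have := mem_range.1 hi; omega
  have hi1 : (i : ℚ) + 1 ∈ localIntegers p := by
    exact_mod_cast natCast_mem (localIntegers p) (i + 1)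
  have hpm : (p : ℚ) ∈ localIntegers p := natCast_mem _ p
  refine mul_mem (add_mem (sub_mem (mul_mem (natCast_mem _ 3) (pow_mem hpm 2))
    (mul_mem (mul_mem (natCast_mem _ 8) hpm) hi1)) (mul_mem (natCast_mem _ 6) (pow_mem hi1 2)))
    (mul_mem (pow_mem (natCast_succ_inv_mem hlt) 4) (pow_mem (natCast_sub_succ_inv_mem hlt) 3))

/-- Reflecting one copy of `H_{p-1}`, use `1/(p+i) - 1/(p-i) = 2i/(i^2-p^2) ≡ 2/i + 2p^2/i^3` modulo
`p^4`. -/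
theorem powDvd_sum_inv_add (hp : 7 ≤ p) :
    PowDvd p 4 (∑ i ∈ range (p - 1), ((p : ℚ) + (i + 1))⁻¹ - 3 * harmonic (p - 1)) := by
  have key : ∑ i ∈ range (p - 1), ((p : ℚ) + (i + 1))⁻¹ - 3 * harmonic (p - 1)
      = 2 * ((p : ℚ) ^ 2 * 1 * ∑ i ∈ range (p - 1), (((i : ℚ) + 1)⁻¹) ^ 3)
        + ∑ i ∈ range (p - 1), (p : ℚ) ^ 4 * (-2 * ((((i : ℚ) + 1)⁻¹) ^ 3
          * (((p : ℚ) + (i + 1))⁻¹ * ((p : ℚ) - (i + 1))⁻¹))) := by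
    have hH : harmonic (p - 1) = ∑ i ∈ range (p - 1), ((i : ℚ) + 1)⁻¹ := by
      simp [harmonic]
    rw [show ∀ x : ℚ, x - 3 * harmonic (p - 1) = x - harmonic (p - 1) - 2 * harmonic (p - 1) by
      intro x; ring, hH]
    nth_rw 1 [← sum_range_reflect_pred p (fun x => x⁻¹)]
    rw [mul_sum, mul_sum, mul_sum, ← sum_sub_distrib, ← sum_sub_distrib, ← sum_add_distrib]
    refine sum_congr rfl fun i hi => ?_
    have h1 : (i : ℚ) + 1 ≠ 0 := by positivity
    have h3 : (p : ℚ) + (i + 1) ≠ 0 := by positivity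
    have h2 : (p : ℚ) - (i + 1) ≠ 0 := by
      have : ((i + 1 : ℕ) : ℚ) < p := by
        have := mem_range.1 hi
        exact_mod_cast (by omega : i + 1 < p)
      push_cast at this
      linarith
    field_simp
    ring
  rw [key]
  refine PowDvd.add (((PowDvd.of_mem (one_mem _)).mul
    (powDvd_two_sum_inv_cube hp)).mul_left (natCast_mem _ 2)) (PowDvd.sum fun i hi => ?_)
  have hlt : i + 1 < p := by have := mem_range.1 hi; omega
  exact PowDvd.of_mem (mul_mem (neg_mem (natCast_mem _ 2))
    (mul_mem (pow_mem (natCast_succ_inv_mem hlt) 3)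
      (mul_mem (natCast_add_succ_inv_mem hlt) (natCast_sub_succ_inv_mem hlt))))

theorem sum_inv_odd (n : ℕ) :
    ∑ j ∈ range n, 1 / (2 * (j : ℚ) + 1) = harmonic (2 * n) - harmonic n / 2 := by
  induction n with
  | zero => simp
  | succ n ih =>
    rw [sum_range_succ, ih, show 2 * (n + 1) = 2 * n + 1 + 1 by ring, harmonic_succ, harmonic_succ,
      harmonic_succ]
    push_cast
    have h1 : (n : ℚ) + 1 ≠ 0 := by positivity
    have h2 : 2 * (n : ℚ) + 1 ≠ 0 := by positivity
    have h3 : 2 * (n : ℚ) + 1 + 1 ≠ 0 := by positivity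
    field_simp
    ring

theorem harmonic_add (m n : ℕ) :
    harmonic (m + n) = harmonic m + ∑ i ∈ range n, ((m : ℚ) + (i + 1))⁻¹ := by
  simp [harmonic, sum_range_add, add_assoc]

theorem powDvd_sum_inv_odd (hp : 7 ≤ p) :
    PowDvd p 4 (∑ j ∈ range p, 1 / (2 * (j : ℚ) + 1) - (1 / p + 7 / 2 * harmonic (p - 1))) := by
  have hp0 : (p : ℚ) ≠ 0 := by positivity
  have e1 : harmonic p = harmonic (p - 1) + (p : ℚ)⁻¹ := by
    conv_lhs => rw [← Nat.sub_add_cancel (show 1 ≤ p by omega), harmonic_succ]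
    rw [Nat.sub_add_cancel (show 1 ≤ p by omega)]
  have e2 : harmonic (2 * p) = harmonic p + ∑ i ∈ range (p - 1), ((p : ℚ) + (i + 1))⁻¹
      + (2 * (p : ℚ))⁻¹ := by
    have : 2 * p = p + (p - 1) + 1 := by omega
    rw [this, harmonic_succ, harmonic_add, ← this]
    push_cast
    rfl
  convert powDvd_sum_inv_add hp using 1
  rw [sum_inv_odd, e2, e1]
  field_simp
  ring

/-- Modulo `p`, `i ↦ p - i` preserves `1/i^2` and swaps the two halves of the full sum. -/
theorem powDvd_sum_half_inv_sq (hp : 7 ≤ p) {h : ℕ} (hh : 2 * h + 1 = p) :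
    PowDvd p 1 (∑ i ∈ range h, (((i : ℚ) + 1)⁻¹) ^ 2) := by
  apply PowDvd.of_two_mul (by omega)
  have key : 2 * ∑ i ∈ range h, (((i : ℚ) + 1)⁻¹) ^ 2
      = ∑ i ∈ range (p - 1), (((i : ℚ) + 1)⁻¹) ^ 2
        - ∑ i ∈ range h, (p : ℚ) ^ 1 * ((2 * ((i : ℚ) + 1) - p) *
          ((((i : ℚ) + 1)⁻¹) ^ 2 * (((p : ℚ) - (i + 1))⁻¹) ^ 2)) := by
    have hr : ∑ i ∈ range h, (((h + i : ℕ) : ℚ) + 1)⁻¹ ^ 2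
        = ∑ i ∈ range h, (((p : ℚ) - (i + 1))⁻¹) ^ 2 := by
      rw [← sum_range_reflect]
      refine sum_congr rfl fun i hi => ?_
      have hi := mem_range.1 hi
      have : h + (h - 1 - i) + 1 = p - (i + 1) := by omega
      rw [← Nat.cast_succ, Nat.succ_eq_add_one, this, Nat.cast_sub (by omega)]
      push_cast
      rfl
    rw [show p - 1 = h + h by omega, sum_range_add, hr, two_mul, add_sub_assoc,
      ← sum_sub_distrib]
    congr 1
    refine sum_congr rfl fun i hi => ?_
    have h1 : (i : ℚ) + 1 ≠ 0 := by positivity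
    have h2 : (p : ℚ) - (i + 1) ≠ 0 := by
      have : ((i + 1 : ℕ) : ℚ) < p := by
        have := mem_range.1 hi
        exact_mod_cast (by omega : i + 1 < p)
      push_cast at this
      linarith
    field_simp
    ring
  rw [key]
  refine (powDvd_sum_inv_pow two_ne_zero (by omega)).sub
    (PowDvd.sum fun i hi => PowDvd.of_mem ?_)
  have hlt : i + 1 < p := by have := mem_range.1 hi; omega
  have hi1 : (i : ℚ) + 1 ∈ localIntegers p := by
    exact_mod_cast natCast_mem (localIntegers p) (i + 1)
  exact mul_mem (sub_mem (mul_mem (natCast_mem _ 2) hi1) (natCast_mem _ p))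
    (mul_mem (pow_mem (natCast_succ_inv_mem hlt) 2) (pow_mem (natCast_sub_succ_inv_mem hlt) 2))

/-! ### The products `∏ (1 - p^2 / i^2)` modulo powers of `p` -/

theorem sineProd_succ (n j : ℕ) :
    sineProd n (j + 1) = sineProd n j * (1 - (n : ℚ) ^ 2 * (((j : ℚ) + 1)⁻¹) ^ 2) :=
  prod_range_succ _ _

theorem powDvd_one_sub_sineProd {j : ℕ} (hj : j < p) : PowDvd p 2 (1 - sineProd p j) := by
  induction j with
  | zero => simpa [sineProd] using PowDvd.zero
  | succ j ih =>
    have hm := pow_mem (natCast_succ_inv_mem hj) 2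
    have : 1 - sineProd p (j + 1) = (1 - (p : ℚ) ^ 2 * (((j : ℚ) + 1)⁻¹) ^ 2) * (1 - sineProd p j)
        + (p : ℚ) ^ 2 * (((j : ℚ) + 1)⁻¹) ^ 2 := by
      rw [sineProd_succ]; ring
    rw [this]
    exact ((ih (by omega)).mul_left (sub_mem (one_mem _)
      (mul_mem (pow_mem (natCast_mem _ p) 2) hm))).add (PowDvd.of_mem hm)

theorem powDvd_one_sub_sineProd_sub {j : ℕ} (hj : j < p) :
    PowDvd p 4 (1 - sineProd p j - (p : ℚ) ^ 2 * 1 * ∑ i ∈ range j, (((i : ℚ) + 1)⁻¹) ^ 2) := by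
  induction j with
  | zero => simpa [sineProd] using PowDvd.zero
  | succ j ih =>
    have hm := pow_mem (natCast_succ_inv_mem hj) 2
    have h := (powDvd_one_sub_sineProd (show j < p by omega)).mul (PowDvd.of_mem (n := 2) hm)
    convert (ih (by omega)).sub h using 1
    rw [sineProd_succ, sum_range_succ]
    ring

theorem powDvd_one_sub_sineProd_half (hp : 7 ≤ p) {h : ℕ} (hh : 2 * h + 1 = p) :
    PowDvd p 3 (1 - sineProd p h) := by
  rw [← sub_add_cancel (1 - sineProd p h)
    ((p : ℚ) ^ 2 * 1 * ∑ i ∈ range h, (((i : ℚ) + 1)⁻¹) ^ 2)]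
  exact ((powDvd_one_sub_sineProd_sub (by omega)).mono (by norm_num)).add
    ((PowDvd.of_mem (one_mem _)).mul (powDvd_sum_half_inv_sq hp hh))

/-- Every `1 - S_j` is divisible by `p^2`. Only `j = (p-1)/2` has `p` in its denominator, and there
divisibility by `p^3` leaves `p^6/p = p^5`. -/
theorem powDvd_sum_one_sub_sineProd_sq (hp : 7 ≤ p) :
    PowDvd p 4 (∑ j ∈ range p, (1 - sineProd p j) ^ 2 / (2 * (j : ℚ) + 1)) := by
  refine PowDvd.sum fun j hj => ?_
  have hj := mem_range.1 hj
  by_cases hh : 2 * j + 1 = p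
  · obtain ⟨r, hr, e⟩ := powDvd_one_sub_sineProd_half hp hh
    refine ⟨(p : ℚ) * r ^ 2, mul_mem (natCast_mem _ p) (pow_mem hr 2), ?_⟩
    have hp0 : (p : ℚ) ≠ 0 := by positivity
    have hq : 2 * (j : ℚ) + 1 = p := by exact_mod_cast hh
    rw [e, hq]
    field_simp
  · have hnd : ¬p ∣ 2 * j + 1 := by
      rintro ⟨c, hc⟩
      have h1 : c < 2 := by
        by_contra! h2
        have := Nat.mul_le_mul_left p h2
        omega
      interval_cases c <;> omega
    have hm := natCast_inv_mem_localIntegers hnd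
    push_cast at hm
    have h2 := powDvd_one_sub_sineProd hj
    rw [div_eq_mul_inv, mul_comm, sq]
    exact (h2.mul h2).mul_left hm

end Local

theorem theorem1p1 (p : ℕ) (hp : p.Prime) (hp7 : 7 ≤ p) :
    RatModEq (p ^ 6)
      (∑ k ∈ Finset.range p, (2 * (k : ℚ) + 1) * (aperyNumber k : ℚ))
      ((p : ℚ) - 7 / 2 * (p : ℚ) ^ 2 * harmonic (p - 1)) := by
  have : Fact p.Prime := ⟨hp⟩
  have hp0 : (p : ℚ) ≠ 0 := by positivity
  apply PowDvd.ratModEq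
  -- The outer factor `p^2` lifts both congruences from `p^4` to `p^6`.
  have h := (PowDvd.of_mem (p := p) (n := 2) (one_mem _)).mul
    ((powDvd_sum_one_sub_sineProd_sq hp7).sub (powDvd_sum_inv_odd hp7))
  convert h using 1
  rw [sum_odd_mul_aperyNumber_eq (hp.odd_of_ne_two (by omega))]
  field_simp
  ring
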